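/- **Setting.** Let $d\ge 1$. A cube of side $S>0$ in $\mathbb R^d$ is subdivided uniformly into a $2^d$-tree; its hypercubes at the leaf level $L$ are the $2^{dL}$ closed cubes of side $H=S/2^L$ of the resulting grid. Two hypercubes $X,Y$ of the same level are admissible if $\max\{\operatorname{diam}X,\operatorname{diam}Y\}\le\sqrt d\,\operatorname{dist}(X,Y)$. The neighbours $\mathcal N(X)$ of $X$ are the hypercubes of its level not admissible with it, and the interaction list $\mathcal{IL}(X)$ consists of the children of the neighbours of the parent of $X$ that are not neighbours of $X$. *Points.* In a hypercube $X$ of side $H$, $N$ points are uniformly distributed with constant $C_u$ if every axis-parallel cube of side $h\ge0$ contains at most $C_u\,(1+N(h/H)^d)$ of them. *Kernel.* A kernel $F(x,y)\in\mathbb C$ is asymptotically smooth on a set $D$ with constants $c,\gamma>0$ if for all $x\ne y$ in $D$ it is $C^\infty$ near that point in each variable separately, and its derivatives of every order $p\ge0$ in $x$, and in $y$, are bounded in norm by $c\,p!\,\gamma^p\,|F(x,y)|/\|x-y\|_2^p$; its values on the diagonal are arbitrary. For hypercubes $a,b$ with targets $u^a_1,\dots,u^a_N$ and sources $v^b_1,\dots,v^b_N$,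 put $K_{ab}=\big(F(u^a_m,v^b_n)\big)_{m,n}$. *Numerical rank.* For a complex matrix $A$, a matrix $S\geq 0$ of the same size and $\varepsilon>0$, let $r_\varepsilon(A;S)$ be the least rank of a matrix $B$ with $|A_{mn}-B_{mn}|\le\varepsilon S_{mn}$ for all $m,n$, and let $r_\varepsilon(A)$ be the least rank of a matrix $B$ with $\|A-B\|_{\max}\le\varepsilon\|A\|_{\max}$, where $\|A\|_{\max}=\max_{m,n}|A_{mn}|$. **Theorem 1.** Let $d\ge1$, $\varepsilon,c,\gamma,C_u>0$ and $\kappa\ge1$. There are a constant $C>0$ and an integer $N_0$, depending only on these numbers, such that the following holds. Let $i$ be a leaf-level hypercube, let $j,k\in\mathcal N(i)$ with $j\in\mathcal{IL}(k)$, let $F$ be asymptotically smooth on $i\cup j\cup k$ with constants $c,\gamma$, let $N\ge3$, and let each of $i,j,k$ hold $N$ target points and $N$ source points, the targets and the sources each being uniformly distributed with constant $C_u$. Suppose $j$ and $k$ are not yet eliminated, so that the elimination of $i$ creates the P2P fill-in $$P2P_{jk}=-K_{ji}K_{ii}K_{ik}.$$ Let $d_j$ and $d_k$ be the dimensions of the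 faces that $j$ and $k$ share with $i$ (dimension $0$ being a vertex), and let $M=|K_{ji}|\,|K_{ii}|\,|K_{ik}|$, with entrywise absolute values. Then $r=r_\varepsilon(P2P_{jk};M)$ satisfies: 1. if $j$ or $k$ shares only a vertex with $i$ (that is, $d_j=0$ or $d_k=0$), then $r\le C\,\log N\,\log^d(\log N)$; 2. if $d_j,d_k\ge1$, then $r\le C\,N^{d'/d}\log^dN$, where $d'=\min\{d_j,d_k\}$; 3. $P2P_{jk}$ is numerically rank deficient: $r<N$ whenever $N\ge N_0$. If moreover $\|M\|_{\max}\le\kappa\,\|P2P_{jk}\|_{\max}$ (for instance if $F\ge0$, where $M=|P2P_{jk}|$ and $\kappa=1$ will do), then 1, 2 and 3 also hold for $r=r_\varepsilon(P2P_{jk})$. -/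

import Mathlib

open scoped Nat ContDiff

noncomputable section

/-- The root hypercube of a `2^d`-tree in `ℝ^d`: its lowest corner and its side length. -/
structure RootCube (d : ℕ) where
  corner : EuclideanSpace ℝ (Fin d)
  side : ℝ
  side_pos : 0 < side

/-- The hypercubes at level `l` of the uniform `2^d`-tree, named by their position in the
`2^l × ⋯ × 2^l` grid. -/
abbrev Box (d l : ℕ) : Type := Fin d → Fin (2 ^ l)

/-- The (closed) hypercube of side `Ω.side / 2 ^ l` at the grid position `b`. -/
def cube {d l : ℕ} (Ω : RootCube d) (b : Box d l) : Set (EuclideanSpace ℝ (Fin d)) :=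
  {x | ∀ m : Fin d,
    Ω.corner m + Ω.side * ((b m : ℕ) : ℝ) / 2 ^ l ≤ x m ∧
    x m ≤ Ω.corner m + Ω.side * (((b m : ℕ) : ℝ) + 1) / 2 ^ l}

/-- The parent of a hypercube in the tree. -/
def parent {d l : ℕ} (b : Box d (l + 1)) : Box d l :=
  fun m => ⟨(b m : ℕ) / 2,
    Nat.div_lt_of_lt_mul (lt_of_lt_of_eq (b m).isLt (pow_succ' 2 l))⟩

/-- `dist(X, Y) = inf {‖x - y‖₂ : x ∈ X, y ∈ Y}`. -/
def setDist {d : ℕ} (X Y : Set (EuclideanSpace ℝ (Fin d))) : ℝ :=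
  sInf (Set.image2 dist X Y)

/-- The strong admissibility condition, with parameter `η = √d`. -/
def Admissible {d : ℕ} (X Y : Set (EuclideanSpace ℝ (Fin d))) : Prop :=
  max (Metric.diam X) (Metric.diam Y) ≤ √(d : ℝ) * setDist X Y

/-- The neighbours of a hypercube: the hypercubes of the same level that are not admissible
with it. -/
def neighbours {d l : ℕ} (Ω : RootCube d) (b : Box d l) : Set (Box d l) :=
  {q | ¬ Admissible (cube Ω b) (cube Ω q)}

/-- The interaction list of a hypercube: the children of the neighbours of its parent that are
not its neighbours.  The root has no parent and an empty interaction list. -/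
def interactionList {d : ℕ} (Ω : RootCube d) : {l : ℕ} → Box d l → Set (Box d l)
  | 0, _ => ∅
  | _ + 1, b => {q | parent q ∈ neighbours Ω (parent b) ∧ q ∉ neighbours Ω b}

/-- The dimension of the face shared by two touching hypercubes (`0` for a vertex): the affine
dimension of their intersection. -/
def sharedDim {d l : ℕ} (Ω : RootCube d) (a b : Box d l) : ℕ :=
  Module.finrank ℝ (vectorSpan ℝ (cube Ω a ∩ cube Ω b))

/-- `N` points are uniformly distributed, with constant `Cu`, in the hypercube `b`: they lie in
it, and every axis-parallel cube of side `h` contains at most `Cu (1 + N (h / H)^d)` of them,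
where `H` is the side of the hypercube, so that `N (h / H)^d` is the proportional share. -/
def UniformlyDistributed {d l N : ℕ} (Cu : ℝ) (Ω : RootCube d) (b : Box d l)
    (p : Fin N → EuclideanSpace ℝ (Fin d)) : Prop :=
  (∀ n, p n ∈ cube Ω b) ∧
  ∀ (a : EuclideanSpace ℝ (Fin d)) (h : ℝ), 0 ≤ h →
    (Set.ncard {n : Fin N | ∀ m : Fin d, a m ≤ p n m ∧ p n m ≤ a m + h} : ℝ) ≤
      Cu * (1 + (N : ℝ) * (h / (Ω.side / 2 ^ l)) ^ d)

/-- Asymptotically smooth kernels: off the diagonal the kernel is smooth in each of its two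
variables, and its derivatives of order `p` are bounded by `c p! γ^p |F(x,y)| / ‖x - y‖^p`.
Nothing is asked of the values on the diagonal. -/
def AsymptoticallySmoothOn {d : ℕ} (c γ : ℝ)
    (F : EuclideanSpace ℝ (Fin d) → EuclideanSpace ℝ (Fin d) → ℂ)
    (D : Set (EuclideanSpace ℝ (Fin d))) : Prop :=
  ∀ x ∈ D, ∀ y ∈ D, x ≠ y →
    ContDiffAt ℝ ∞ (fun z => F x z) y ∧ ContDiffAt ℝ ∞ (fun z => F z y) x ∧
    ∀ p : ℕ,
      ‖iteratedFDeriv ℝ p (fun z => F x z) y‖ ≤ c * p ! * γ ^ p * ‖F x y‖ / ‖x - y‖ ^ p ∧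
      ‖iteratedFDeriv ℝ p (fun z => F z y) x‖ ≤ c * p ! * γ ^ p * ‖F x y‖ / ‖x - y‖ ^ p

/-- The interaction matrix `K_ab`, from the sources `v b` in the hypercube `b` to the targets
`u a` in the hypercube `a`. -/
def interaction {d l N : ℕ} (F : EuclideanSpace ℝ (Fin d) → EuclideanSpace ℝ (Fin d) → ℂ)
    (u v : Box d l → Fin N → EuclideanSpace ℝ (Fin d)) (a b : Box d l) :
    Matrix (Fin N) (Fin N) ℂ :=
  Matrix.of fun m n => F (u a m) (v b n)

/-- The P2P fill-in `P2P_jk = - K_ji K_ii K_ik` created by the elimination of `i`. -/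
def fillInP2P {d l N : ℕ} (F : EuclideanSpace ℝ (Fin d) → EuclideanSpace ℝ (Fin d) → ℂ)
    (u v : Box d l → Fin N → EuclideanSpace ℝ (Fin d)) (i j k : Box d l) :
    Matrix (Fin N) (Fin N) ℂ :=
  -(interaction F u v j i * interaction F u v i i * interaction F u v i k)

/-- The matrix of the absolute values of the entries. -/
def entryAbs {N : ℕ} (A : Matrix (Fin N) (Fin N) ℂ) : Matrix (Fin N) (Fin N) ℝ :=
  A.map fun z => ‖z‖

/-- `|K_ji| |K_ii| |K_ik|`: the magnitudes of the entries of the fill-in before any cancellation.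
It is `|P2P_jk|` when the kernel is nonnegative. -/
def fillInMagnitude {d l N : ℕ} (F : EuclideanSpace ℝ (Fin d) → EuclideanSpace ℝ (Fin d) → ℂ)
    (u v : Box d l → Fin N → EuclideanSpace ℝ (Fin d)) (i j k : Box d l) :
    Matrix (Fin N) (Fin N) ℝ :=
  entryAbs (interaction F u v j i) * entryAbs (interaction F u v i i) *
    entryAbs (interaction F u v i k)

/-- The maximum norm `max |A_mn|` of a matrix. -/
def maxNorm {N : ℕ} {R : Type*} [Norm R] (A : Matrix (Fin N) (Fin N) R) : ℝ :=
  ⨆ q : Fin N × Fin N, ‖A q.1 q.2‖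

/-- The numerical rank of `A` at tolerance `ε` relative to the magnitudes `S`: the least rank of
a matrix `B` with `|A_mn - B_mn| ≤ ε S_mn` for all `m, n`. -/
def numRankRel {N : ℕ} (ε : ℝ) (S : Matrix (Fin N) (Fin N) ℝ) (A : Matrix (Fin N) (Fin N) ℂ) :
    ℕ :=
  sInf {r | ∃ B : Matrix (Fin N) (Fin N) ℂ, B.rank = r ∧ ∀ m n, ‖A m n - B m n‖ ≤ ε * S m n}

/-- The numerical rank of `A` at relative tolerance `ε`: the least rank of a matrix `B` with
`max |A_mn - B_mn| ≤ ε max |A_mn|`. -/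
def numRank {N : ℕ} (ε : ℝ) (A : Matrix (Fin N) (Fin N) ℂ) : ℕ :=
  sInf {r | ∃ B : Matrix (Fin N) (Fin N) ℂ, B.rank = r ∧ maxNorm (A - B) ≤ ε * maxNorm A}

/-- The rank `r` of an `N × N` block obeys the rates, with constant `C`, when the faces shared
have dimensions `dj` and `dk`. -/
def ObeysRates (d : ℕ) (C : ℝ) (dj dk N r : ℕ) : Prop :=
  (dj = 0 ∨ dk = 0 → (r : ℝ) ≤ C * (Real.log N * Real.log (Real.log N) ^ d)) ∧
  (1 ≤ dj → 1 ≤ dk →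
    (r : ℝ) ≤ C * ((N : ℝ) ^ (((min dj dk : ℕ) : ℝ) / (d : ℝ)) * Real.log N ^ d))

end

/-!
The tolerance `ε` is fixed, so approximating the kernel by constants on clusters of points already
suffices. For `f = F x ·` the first-order derivative bound reads `‖f'‖ ≤ c γ ‖f‖ / ‖x - ·‖`, and
Grönwall's inequality turns it into `|F x y - F x z| ≤ ε |F x y|` as soon as
`‖y - z‖ ≤ θ ‖x - y‖`, with `θ` depending on `c`, `γ`, `ε` only
(`AsymptoticallySmoothOn.exists_ratio`). Group the sources of `i` so that each group has diameter
at most `θ` times its distance to `j`, and replace each column of `K_ji` by the column of a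
representative of its group. The new matrix has rank at most the number of groups, and it differs
from `K_ji` by at most `ε |K_ji|` entrywise; after multiplication by `K_ii K_ik` the error is at most
`ε |K_ji| |K_ii| |K_ik|`. The same works with the targets of `i`, the rows of `K_ik` and the
distance to `k`, so the better of the two bounds holds (`exists_approx_fillInP2P`).

The groups are counted by dyadic refinement towards the shared face (`exists_representatives`,
`exists_clustering`). Write `e` for the number of coordinates in which `i` and `j` have the same
position. The points of `i` at distance about `2^-s` (in units of the side) from the face lie in
`O(2^(s e))` cells of side proportional to `2^-s`, one group each. Refinement stops at the level `S`
with `2^S ≈ N^(1/d)`, where a cell holds `O(1)` points by uniformity and every point may form its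
own group. With `S = O(log N)` this gives `O(N^(e/d) log N)` groups. Finally `e` is at most the
dimension of the shared face (`card_sharedDirections_le_sharedDim`), and `e < d` because `i`, `j`
and `k` are distinct (`ne_of_mem_interactionList`), which yields both the rates and the rank
deficiency. The bound relative to `max |P2P_jk|` follows by running this with `ε / κ` for `ε`.
-/

/-! ### Clustering by dyadic refinement -/

open Finset in
/-- Points `a n` of the unit cube can be replaced by few representatives `a (σ n)`, each moved point
by at most `2 / Q` times one of its coordinates outside `J`, that is, relative to its distance from
the face where those coordinates vanish. Points within `2^-S` of that face stay in place; `B` bounds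
how many of them share a cell. -/
theorem exists_representatives {d : ℕ} {ι : Type*} [Fintype ι] [DecidableEq ι] [Nonempty ι]
    (a : ι → Fin d → ℝ) (J : Finset (Fin d)) (h0 : ∀ n m, 0 ≤ a n m) (h1 : ∀ n m, a n m ≤ 1)
    (S Q B : ℕ) (hQ : 1 ≤ Q)
    (hB : ∀ n₀, Set.ncard {n | ∀ m, |a n m - a n₀ m| ≤ (1 / 2) ^ S} ≤ B) :
    ∃ σ : ι → ι, #(univ.image σ) ≤ B * ((S + 1) * ((2 * Q) ^ d * 2 ^ (S * #J))) ∧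
      ∀ n, σ n = n ∨ ∃ m ∉ J, ∀ m', |a n m' - a (σ n) m'| ≤ 2 / Q * a n m := by
  classical
  -- `2 ^ (-level n)` is the sup-distance of `a n` from the face, rounded up to a power of `1 / 2` and
  -- to at least `2 ^ (-S)`; the cells of a level have side `2 ^ (-level n) / Q`
  let level : ι → ℕ := fun n => Nat.findGreatest (fun s => ∀ m ∉ J, a n m ≤ (1 / 2) ^ s) S
  let key : ι → ℕ × (Fin d → ℕ) := fun n => (level n, fun m => ⌊a n m * (Q * 2 ^ level n)⌋₊)
  have level_le n : level n ≤ S := Nat.findGreatest_le S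
  have le_level n : ∀ m ∉ J, a n m ≤ (1 / 2) ^ level n :=
    Nat.findGreatest_spec (P := fun s => ∀ m ∉ J, a n m ≤ (1 / 2) ^ s) (Nat.zero_le S)
      fun m _ => by simpa using h1 n m
  have hQ0 : (0 : ℝ) < Q := by exact_mod_cast hQ
  have hQ1 : (1 : ℝ) ≤ Q := by exact_mod_cast hQ
  have near {n n' : ι} (h : key n = key n') (m : Fin d) :
      |a n m - a n' m| ≤ 1 / Q * (1 / 2) ^ level n := by
    have hl : level n = level n' := congrArg Prod.fst h
    have hf : ⌊a n m * (Q * 2 ^ level n)⌋₊ = ⌊a n' m * (Q * 2 ^ level n)⌋₊ := by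
      have := congrFun (congrArg Prod.snd h) m
      simpa only [key, ← hl] using this
    have hs : (0 : ℝ) < Q * 2 ^ level n := by positivity
    have e : 1 / (Q : ℝ) * (1 / 2) ^ level n = 1 / (Q * 2 ^ level n) := by
      rw [one_div_pow]; field_simp
    have l1 := Nat.floor_le (mul_nonneg (h0 n m) hs.le)
    have l2 := Nat.floor_le (mul_nonneg (h0 n' m) hs.le)
    have u1 := Nat.lt_floor_add_one (a n m * (Q * 2 ^ level n))
    have u2 := Nat.lt_floor_add_one (a n' m * (Q * 2 ^ level n))
    rw [hf] at l1 u1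
    have hmul : |(a n m - a n' m) * (Q * 2 ^ level n)| ≤ 1 := by
      rw [sub_mul, abs_le]
      constructor <;> linarith
    rwa [abs_mul, abs_of_pos hs, ← le_div_iff₀ hs, ← e] at hmul
  let σ : ι → ι := fun n => if level n = S then n else Function.invFun key (key n)
  have key_σ n : key (σ n) = key n := by
    by_cases h : level n = S
    · simp only [σ, if_pos h]
    · simp only [σ, if_neg h]
      exact Function.invFun_eq ⟨n, rfl⟩
  refine ⟨σ, ?_, fun n => ?_⟩
  · let keys : Finset (ℕ × (Fin d → ℕ)) := range (S + 1) ×ˢ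
      Fintype.piFinset fun m => if m ∈ J then range (Q * 2 ^ S + 1) else range (Q + 1)
    have hmaps : ∀ n ∈ univ.image σ, key n ∈ keys := by
      intro n _
      simp only [keys, mem_product, mem_range, Fintype.mem_piFinset]
      refine ⟨Nat.lt_succ_of_le (level_le n), fun m => ?_⟩
      have hpow : (2 : ℝ) ^ level n ≤ 2 ^ S := pow_le_pow_right₀ one_le_two (level_le n)
      by_cases hm : m ∈ J
      · rw [if_pos hm, mem_range, Nat.lt_succ_iff]
        refine Nat.floor_le_of_le ?_
        push_cast
        calc a n m * (Q * 2 ^ level n) ≤ 1 * (Q * 2 ^ S) :=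
              mul_le_mul (h1 n m) (by gcongr) (by positivity) zero_le_one
          _ = _ := one_mul _
      · rw [if_neg hm, mem_range, Nat.lt_succ_iff]
        refine Nat.floor_le_of_le ?_
        calc a n m * (Q * 2 ^ level n) ≤ (1 / 2) ^ level n * (Q * 2 ^ level n) := by
              gcongr; exact le_level n m hm
          _ = Q := by rw [one_div_pow]; field_simp
    have hfib : ∀ k ∈ keys, #{n ∈ univ.image σ | key n = k} ≤ B := by
      intro k _
      rcases ({n ∈ univ.image σ | key n = k} : Finset ι).eq_empty_or_nonempty with he | ⟨n₀, hn₀⟩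
      · rw [he]; exact Nat.zero_le _
      · refine le_trans ?_ (hB n₀)
        obtain ⟨hn₀', hk⟩ := mem_filter.mp hn₀
        rw [← Set.ncard_coe_finset]
        refine Set.ncard_le_ncard ?_ (Set.toFinite _)
        intro n hn m
        obtain ⟨hn', hkn⟩ := mem_filter.mp (mem_coe.mp hn)
        by_cases hl : level n = S
        · refine (near (hkn.trans hk.symm) m).trans ?_
          rw [hl]
          refine mul_le_of_le_one_left (by positivity) ?_
          rw [div_le_one hQ0]; exact hQ1
        · -- above the last level a key has only one representative
          have uniq : ∀ n₁ ∈ univ.image σ, key n₁ = k → level n₁ ≠ S →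
              n₁ = Function.invFun key k := by
            intro n₁ h₁ hk₁ hl₁
            obtain ⟨n₂, -, rfl⟩ := mem_image.mp h₁
            have hk₂ : key n₂ = k := (key_σ n₂).symm.trans hk₁
            have hl₂ : level n₂ ≠ S := by
              have : level (σ n₂) = level n₂ := congrArg Prod.fst (key_σ n₂)
              rwa [this] at hl₁
            simp only [σ, if_neg hl₂, hk₂]
          have hl₀ : level n₀ ≠ S := by
            have : level n = level n₀ := congrArg Prod.fst (hkn.trans hk.symm)
            rwa [← this]
          rw [uniq n hn' hkn hl, uniq n₀ hn₀' hk hl₀, sub_self, abs_zero]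
          positivity
    refine (card_le_mul_card_image_of_maps_to hmaps B hfib).trans ?_
    refine Nat.mul_le_mul_left B ?_
    rw [card_product, card_range, Fintype.card_piFinset]
    refine Nat.mul_le_mul_left _ ?_
    calc ∏ m, #(if m ∈ J then range (Q * 2 ^ S + 1) else range (Q + 1))
        ≤ ∏ m : Fin d, (2 * Q) * (if m ∈ J then 2 ^ S else 1) := by
          refine prod_le_prod' fun m _ => ?_
          split_ifs
          · rw [card_range]
            nlinarith [Nat.one_le_two_pow (n := S), Nat.mul_le_mul hQ (Nat.one_le_two_pow (n := S))]
          · rw [card_range]; omega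
      _ = (2 * Q) ^ d * 2 ^ (S * #J) := by
          rw [prod_mul_distrib, prod_const, card_univ, Fintype.card_fin, prod_ite, prod_const,
            prod_const_one, mul_one, pow_mul]
          simp
  · by_cases hl : level n = S
    · exact Or.inl (if_pos hl)
    · right
      have hlt : level n < S := lt_of_le_of_ne (level_le n) hl
      have := Nat.findGreatest_is_greatest (P := fun s => ∀ m ∉ J, a n m ≤ (1 / 2) ^ s)
        (Nat.lt_succ_self (level n)) hlt
      push Not at this
      obtain ⟨m, hm, hlt'⟩ := this
      refine ⟨m, hm, fun m' => (near (key_σ n).symm m').trans ?_⟩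
      calc 1 / (Q : ℝ) * (1 / 2) ^ level n = 2 / Q * (1 / 2) ^ (level n + 1) := by
            rw [pow_succ]; ring
        _ ≤ 2 / Q * a n m := by gcongr

/-! ### Geometry of the hypercubes -/

theorem dist_le_of_forall_abs_sub_le {d : ℕ} {x y : EuclideanSpace ℝ (Fin d)} {h : ℝ}
    (hh : 0 ≤ h) (H : ∀ m, |x m - y m| ≤ h) : dist x y ≤ √d * h := by
  rw [EuclideanSpace.dist_eq, ← Real.sqrt_sq hh, ← Real.sqrt_mul (Nat.cast_nonneg d)]
  refine Real.sqrt_le_sqrt ?_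
  calc ∑ m, dist (x m) (y m) ^ 2 ≤ ∑ _m : Fin d, h ^ 2 :=
        Finset.sum_le_sum fun m _ => pow_le_pow_left₀ dist_nonneg (H m) 2
    _ = d * h ^ 2 := by simp

theorem abs_sub_le_dist {d : ℕ} (x y : EuclideanSpace ℝ (Fin d)) (m : Fin d) :
    |x m - y m| ≤ dist x y := by
  rw [dist_eq_norm]
  exact PiLp.norm_apply_le (x - y) m

theorem convex_cube {d l : ℕ} (Ω : RootCube d) (b : Box d l) : Convex ℝ (cube Ω b) := by
  intro x hx y hy s t hs ht hst m
  have h1 := mul_le_mul_of_nonneg_left (hx m).1 hs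
  have h2 := mul_le_mul_of_nonneg_left (hy m).1 ht
  have h3 := mul_le_mul_of_nonneg_left (hx m).2 hs
  have h4 := mul_le_mul_of_nonneg_left (hy m).2 ht
  obtain rfl : s = 1 - t := by linarith
  simp only [PiLp.add_apply, PiLp.smul_apply, smul_eq_mul]
  constructor <;> linarith

/-- Membership in a hypercube in terms of its side length `Ω.side / 2 ^ l`. -/
theorem mem_cube_iff {d l : ℕ} (Ω : RootCube d) (b : Box d l) (x : EuclideanSpace ℝ (Fin d)) :
    x ∈ cube Ω b ↔ ∀ m, Ω.corner m + Ω.side / 2 ^ l * (b m : ℕ) ≤ x m ∧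
      x m ≤ Ω.corner m + Ω.side / 2 ^ l * ((b m : ℕ) + 1) := by
  simp only [cube, Set.mem_ofPred_eq, div_mul_eq_mul_div]

theorem RootCube.boxSide_pos {d : ℕ} (Ω : RootCube d) (l : ℕ) : 0 < Ω.side / 2 ^ l :=
  div_pos Ω.side_pos (by positivity)

theorem corner_mem_cube {d l : ℕ} (Ω : RootCube d) (b : Box d l) :
    WithLp.toLp 2 (fun m => Ω.corner m + Ω.side / 2 ^ l * (b m : ℕ)) ∈ cube Ω b := by
  have := Ω.boxSide_pos l
  rw [mem_cube_iff]
  intro m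
  constructor <;> simp only <;> linarith

theorem diam_cube_le {d l : ℕ} (Ω : RootCube d) (b : Box d l) :
    Metric.diam (cube Ω b) ≤ √d * (Ω.side / 2 ^ l) := by
  have hpos := Ω.boxSide_pos l
  refine Metric.diam_le_of_forall_dist_le (by positivity) fun x hx y hy => ?_
  rw [mem_cube_iff] at hx hy
  refine dist_le_of_forall_abs_sub_le hpos.le fun m => ?_
  rw [abs_le]
  constructor <;> linarith [(hx m).1, (hx m).2, (hy m).1, (hy m).2]

theorem Admissible.symm {d : ℕ} {X Y : Set (EuclideanSpace ℝ (Fin d))} (h : Admissible X Y) :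
    Admissible Y X := by
  have : setDist Y X = setDist X Y := by
    unfold setDist
    rw [Set.image2_swap]
    simp only [dist_comm]
  rwa [Admissible, this, max_comm]

/-- Hypercubes separated by a gap in some coordinate are admissible. -/
theorem admissible_of_add_two_le {d l : ℕ} (Ω : RootCube d) {a b : Box d l} {m : Fin d}
    (h : (a m : ℕ) + 2 ≤ b m) : Admissible (cube Ω a) (cube Ω b) := by
  have hpos := Ω.boxSide_pos l
  have hdist : Ω.side / 2 ^ l ≤ setDist (cube Ω a) (cube Ω b) := by
    refine le_csInf ⟨_, _, corner_mem_cube Ω a, _, corner_mem_cube Ω b, rfl⟩ ?_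
    rintro _ ⟨x, hx, y, hy, rfl⟩
    rw [mem_cube_iff] at hx hy
    have h' : ((a m : ℕ) : ℝ) + 2 ≤ (b m : ℕ) := by exact_mod_cast h
    have := mul_le_mul_of_nonneg_left h' hpos.le
    have h3 := abs_sub_le_dist x y m
    rw [abs_sub_comm] at h3
    linarith [(hx m).2, (hy m).1, le_abs_self (y m - x m)]
  refine max_le ((diam_cube_le Ω a).trans ?_) ((diam_cube_le Ω b).trans ?_) <;> gcongr

theorem le_add_one_of_mem_neighbours {d l : ℕ} {Ω : RootCube d} {a b : Box d l}
    (h : b ∈ neighbours Ω a) (m : Fin d) : (a m : ℕ) ≤ b m + 1 ∧ (b m : ℕ) ≤ a m + 1 := by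
  constructor <;> by_contra! h'
  · exact h (admissible_of_add_two_le Ω (m := m) (by omega)).symm
  · exact h (admissible_of_add_two_le Ω (m := m) (by omega))

/-- The coordinates in which two hypercubes have the same grid position; for touching hypercubes
these are the directions of the shared face. -/
def sharedDirections {d l : ℕ} (a b : Box d l) : Finset (Fin d) := {m | a m = b m}

theorem card_sharedDirections_lt {d l : ℕ} {a b : Box d l} (h : a ≠ b) :
    (sharedDirections a b).card < d := by
  obtain ⟨m, hm⟩ := Function.ne_iff.mp h
  calc (sharedDirections a b).card < (Finset.univ : Finset (Fin d)).card :=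
        Finset.card_lt_univ_of_notMem (x := m) (by simpa [sharedDirections] using hm)
    _ = d := by simp

/-- The shared face contains, with its lowest vertex, an edge in each shared direction. -/
theorem card_sharedDirections_le_sharedDim {d l : ℕ} {Ω : RootCube d} {a b : Box d l}
    (h : b ∈ neighbours Ω a) : (sharedDirections a b).card ≤ sharedDim Ω a b := by
  have hpos := Ω.boxSide_pos l
  have hadj := le_add_one_of_mem_neighbours h
  -- the lowest vertex of the shared face
  let p : EuclideanSpace ℝ (Fin d) := WithLp.toLp 2
    fun m => Ω.corner m + Ω.side / 2 ^ l * ((max (a m : ℕ) (b m) : ℕ) : ℝ)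
  have hmem : ∀ t : ℝ, 0 ≤ t → t ≤ Ω.side / 2 ^ l → ∀ m ∈ sharedDirections a b,
      p + t • EuclideanSpace.single m (1 : ℝ) ∈ cube Ω a ∩ cube Ω b := by
    intro t ht0 ht m hm
    have hm' : a m = b m := by simpa [sharedDirections] using hm
    have key : ∀ m', ((a m' : ℕ) : ℝ) ≤ (max (a m' : ℕ) (b m') : ℕ) ∧
        ((b m' : ℕ) : ℝ) ≤ (max (a m' : ℕ) (b m') : ℕ) ∧
        ((max (a m' : ℕ) (b m') : ℕ) : ℝ) ≤ (a m' : ℕ) + 1 ∧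
        ((max (a m' : ℕ) (b m') : ℕ) : ℝ) ≤ (b m' : ℕ) + 1 := by
      intro m'
      have := hadj m'
      refine ⟨Nat.cast_le.mpr (by omega), Nat.cast_le.mpr (by omega), ?_, ?_⟩ <;>
        rw [← Nat.cast_succ] <;> exact Nat.cast_le.mpr (by omega)
    rw [Set.mem_inter_iff, mem_cube_iff, mem_cube_iff, ← forall_and]
    intro m'
    obtain ⟨k1, k2, k3, k4⟩ := key m'
    have k1 := mul_le_mul_of_nonneg_left k1 hpos.le
    have k2 := mul_le_mul_of_nonneg_left k2 hpos.le
    have k3 := mul_le_mul_of_nonneg_left k3 hpos.le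
    have k4 := mul_le_mul_of_nonneg_left k4 hpos.le
    rcases eq_or_ne m' m with rfl | hne
    · have e : (p + t • EuclideanSpace.single m' (1 : ℝ)) m' =
          Ω.corner m' + Ω.side / 2 ^ l * (a m' : ℕ) + t := by
        simp [p, hm']
      rw [e, ← hm']
      refine ⟨⟨?_, ?_⟩, ?_, ?_⟩ <;> linarith
    · have e : (p + t • EuclideanSpace.single m (1 : ℝ)) m' =
          Ω.corner m' + Ω.side / 2 ^ l * ((max (a m' : ℕ) (b m') : ℕ) : ℝ) := by
        simp [p, hne]
      rw [e]
      refine ⟨⟨?_, ?_⟩, ?_, ?_⟩ <;> linarith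
  let V := vectorSpan ℝ (cube Ω a ∩ cube Ω b)
  have hV : ∀ m ∈ sharedDirections a b, EuclideanSpace.single m (1 : ℝ) ∈ V := by
    intro m hm
    have h1 := vsub_mem_vectorSpan ℝ (hmem _ hpos.le le_rfl m hm) (hmem 0 le_rfl hpos.le m hm)
    rw [zero_smul, add_zero, vsub_eq_sub, add_sub_cancel_left] at h1
    exact (Submodule.smul_mem_iff _ hpos.ne').mp h1
  let e : sharedDirections a b → V := fun m => ⟨_, hV m m.2⟩
  have hli : LinearIndependent ℝ e := by
    refine LinearIndependent.of_comp V.subtype ?_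
    have := (EuclideanSpace.basisFun (Fin d) ℝ).toBasis.linearIndependent.comp
      (fun m : sharedDirections a b => (m : Fin d)) Subtype.val_injective
    simpa [Function.comp_def, e] using! this
  simpa using! hli.fintype_card_le_finrank

/-- If `i = j`, then `k` is a neighbour of `j`, which an interaction list excludes. -/
theorem ne_of_mem_interactionList {d L : ℕ} {Ω : RootCube d} {i j k : Box d L}
    (hk : k ∈ neighbours Ω i) (hjk : j ∈ interactionList Ω k) :
    i ≠ j := by
  have hadm : Admissible (cube Ω k) (cube Ω j) := by
    cases L with
    | zero => exact hjk.elim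
    | succ L => exact not_not.mp hjk.2
  rintro rfl
  exact hk hadm.symm

/-! ### Clusters of uniformly distributed points -/

/-- Coordinates of a point relative to the hypercube `a`, in units of its side. In each direction
they start at the lower end of `a`, or at the upper end if `b` lies above `a` there, so that the
coordinates in which `a` and `b` have different positions vanish on the face towards `b`. -/
noncomputable def faceCoord {d l : ℕ} (Ω : RootCube d) (a b : Box d l)
    (x : EuclideanSpace ℝ (Fin d)) (m : Fin d) : ℝ :=
  if (a m : ℕ) < b m then (Ω.corner m + Ω.side / 2 ^ l * ((a m : ℕ) + 1) - x m) / (Ω.side / 2 ^ l)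
  else (x m - (Ω.corner m + Ω.side / 2 ^ l * (a m : ℕ))) / (Ω.side / 2 ^ l)

theorem faceCoord_nonneg {d l : ℕ} {Ω : RootCube d} {a : Box d l} (b : Box d l)
    {x : EuclideanSpace ℝ (Fin d)} (hx : x ∈ cube Ω a) (m : Fin d) : 0 ≤ faceCoord Ω a b x m := by
  have := Ω.boxSide_pos l
  obtain ⟨h1, h2⟩ := (mem_cube_iff Ω a x).mp hx m
  unfold faceCoord
  split_ifs <;> exact div_nonneg (by linarith) this.le

theorem faceCoord_le_one {d l : ℕ} {Ω : RootCube d} {a : Box d l} (b : Box d l)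
    {x : EuclideanSpace ℝ (Fin d)} (hx : x ∈ cube Ω a) (m : Fin d) : faceCoord Ω a b x m ≤ 1 := by
  have := Ω.boxSide_pos l
  obtain ⟨h1, h2⟩ := (mem_cube_iff Ω a x).mp hx m
  unfold faceCoord
  split_ifs <;> rw [div_le_one this] <;> linarith

theorem abs_faceCoord_sub {d l : ℕ} (Ω : RootCube d) (a b : Box d l)
    (x y : EuclideanSpace ℝ (Fin d)) (m : Fin d) :
    |faceCoord Ω a b x m - faceCoord Ω a b y m| = |x m - y m| / (Ω.side / 2 ^ l) := by
  have := Ω.boxSide_pos l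
  unfold faceCoord
  split_ifs
  · rw [← sub_div, abs_div, abs_of_pos this, sub_sub_sub_cancel_left, abs_sub_comm]
  · rw [← sub_div, abs_div, abs_of_pos this, sub_sub_sub_cancel_right]

theorem faceCoord_mul_le_dist {d l : ℕ} {Ω : RootCube d} {a b : Box d l}
    {x y : EuclideanSpace ℝ (Fin d)} (hy : y ∈ cube Ω b) {m : Fin d}
    (hm : m ∉ sharedDirections a b) :
    faceCoord Ω a b x m * (Ω.side / 2 ^ l) ≤ dist y x := by
  have hpos := Ω.boxSide_pos l
  have hne : (a m : ℕ) ≠ b m := by simpa [sharedDirections, Fin.ext_iff] using hm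
  obtain ⟨h1, h2⟩ := (mem_cube_iff Ω b y).mp hy m
  refine le_trans ?_ (abs_sub_le_dist y x m)
  unfold faceCoord
  split_ifs with h
  · rw [div_mul_cancel₀ _ hpos.ne']
    have h' : ((a m : ℕ) : ℝ) + 1 ≤ (b m : ℕ) := by exact_mod_cast h
    have := mul_le_mul_of_nonneg_left h' hpos.le
    linarith [le_abs_self (y m - x m)]
  · rw [div_mul_cancel₀ _ hpos.ne']
    have h' : ((b m : ℕ) : ℝ) + 1 ≤ (a m : ℕ) := by exact_mod_cast (by omega : (b m : ℕ) + 1 ≤ a m)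
    have := mul_le_mul_of_nonneg_left h' hpos.le
    linarith [neg_abs_le (y m - x m)]

theorem one_le_log_of_three_le {N : ℕ} (hN : 3 ≤ N) : 1 ≤ Real.log N := by
  rw [Real.le_log_iff_exp_le (by positivity)]
  have : (3 : ℝ) ≤ N := by exact_mod_cast hN
  linarith [Real.exp_one_lt_d9]

/-- The level `Nat.log 2 N / d` is the largest `S` with `2 ^ (S * d) ≤ N`. -/
theorem levels_mul_cells_le {d N : ℕ} (hd : 1 ≤ d) (hN : 3 ≤ N) (e : ℕ) :
    ((Nat.log 2 N / d + 1 : ℕ) : ℝ) * 2 ^ (Nat.log 2 N / d * e) ≤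
      3 * ((N : ℝ) ^ ((e : ℝ) / d) * Real.log N) := by
  set S := Nat.log 2 N / d
  have hN0 : (0 : ℝ) < N := by positivity
  have hd0 : (0 : ℝ) < d := by exact_mod_cast hd
  have hlog := one_le_log_of_three_le hN
  have hpow : (2 : ℝ) ^ Nat.log 2 N ≤ N := by exact_mod_cast Nat.pow_log_le_self 2 (by omega)
  have hS : (S : ℝ) ≤ 2 * Real.log N := by
    have h1 : (Nat.log 2 N : ℝ) * Real.log 2 ≤ Real.log N := by
      rw [← Real.log_pow]; exact Real.log_le_log (by positivity) hpow
    have h2 : (S : ℝ) ≤ Nat.log 2 N := by exact_mod_cast Nat.div_le_self _ _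
    nlinarith [Real.log_two_gt_d9, (Nat.cast_nonneg _ : (0 : ℝ) ≤ Nat.log 2 N)]
  have hcell : (2 : ℝ) ^ (S * e) ≤ (N : ℝ) ^ ((e : ℝ) / d) := by
    have h1 : ((2 : ℝ) ^ S) ^ d ≤ N := by
      rw [← pow_mul]
      refine le_trans (pow_le_pow_right₀ one_le_two ?_) hpow
      exact Nat.div_mul_le_self _ _
    calc (2 : ℝ) ^ (S * e) = (((2 : ℝ) ^ S) ^ d) ^ ((e : ℝ) / d) := by
          rw [← Real.rpow_natCast (2 ^ S) d, ← Real.rpow_mul (by positivity),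
            mul_div_cancel₀ _ hd0.ne', Real.rpow_natCast, pow_mul]
      _ ≤ _ := Real.rpow_le_rpow (by positivity) h1 (by positivity)
  calc ((S + 1 : ℕ) : ℝ) * 2 ^ (S * e) ≤ (3 * Real.log N) * (N : ℝ) ^ ((e : ℝ) / d) := by
        gcongr
        push_cast
        linarith
    _ = _ := by ring

/-- Uniformly distributed points of `a` fall into `O(N^(e/d) log N)` clusters, each of diameter at
most `θ` times its distance from `b`, where `e` is the number of shared directions. The clusters
are given by the map `σ` to representatives. -/
theorem exists_clustering {d : ℕ} (hd : 1 ≤ d) {Cu θ : ℝ} (hCu : 0 < Cu) (hθ : 0 < θ) :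
    ∃ A : ℝ, 0 < A ∧ ∀ (Ω : RootCube d) (L : ℕ) (a b : Box d L) (N : ℕ)
      (p : Fin N → EuclideanSpace ℝ (Fin d)), 3 ≤ N → UniformlyDistributed Cu Ω a p →
      ∃ σ : Fin N → Fin N,
        ((Finset.univ.image σ).card : ℝ) ≤
          A * ((N : ℝ) ^ (((sharedDirections a b).card : ℝ) / d) * Real.log N) ∧
        ∀ n, ∀ y ∈ cube Ω b, dist (p n) (p (σ n)) ≤ θ * dist y (p n) := by
  let B := ⌈Cu * (1 + 4 ^ d)⌉₊
  let Q := ⌈2 * √d / θ⌉₊ + 1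
  have hB : 0 < B := Nat.ceil_pos.mpr (by positivity)
  refine ⟨B * (2 * Q) ^ d * 3, by positivity, fun Ω L a b N p hN hp => ?_⟩
  have hpos := Ω.boxSide_pos L
  set H := Ω.side / 2 ^ L
  let S := Nat.log 2 N / d
  let J := sharedDirections a b
  have : Nonempty (Fin N) := ⟨⟨0, by omega⟩⟩
  have hcell : ∀ n₀, Set.ncard {n | ∀ m,
      |faceCoord Ω a b (p n) m - faceCoord Ω a b (p n₀) m| ≤ (1 / 2) ^ S} ≤ B := by
    intro n₀
    -- a ball of radius `2 ^ (-S)` in the sup-distance is a cube of twice that side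
    have hcount := hp.2 (WithLp.toLp 2 fun m => p n₀ m - H * (1 / 2) ^ S) (2 * (H * (1 / 2) ^ S))
      (by positivity)
    have hsub : {n | ∀ m, |faceCoord Ω a b (p n) m - faceCoord Ω a b (p n₀) m| ≤ (1 / 2) ^ S} ⊆
        {n | ∀ m, WithLp.toLp 2 (fun m => p n₀ m - H * (1 / 2) ^ S) m ≤ p n m ∧
          p n m ≤ WithLp.toLp 2 (fun m => p n₀ m - H * (1 / 2) ^ S) m +
            2 * (H * (1 / 2) ^ S)} := by
      intro n hn m
      have h := hn m
      rw [abs_faceCoord_sub, div_le_iff₀ hpos, mul_comm, abs_le] at h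
      simp only
      constructor <;> linarith
    have hNd : (N : ℝ) * (2 * (H * (1 / 2) ^ S) / H) ^ d ≤ 4 ^ d := by
      have h1 : N < (2 ^ (S + 1)) ^ d := by
        rw [← pow_mul]
        refine (Nat.lt_pow_succ_log_self one_lt_two N).trans_le (Nat.pow_le_pow_right two_pos ?_)
        rw [mul_comm]
        exact Nat.lt_mul_div_succ _ hd
      have h2 : (N : ℝ) ≤ (2 ^ (S + 1)) ^ d := by exact_mod_cast h1.le
      calc (N : ℝ) * (2 * (H * (1 / 2) ^ S) / H) ^ d
          ≤ (2 ^ (S + 1)) ^ d * (2 * (H * (1 / 2) ^ S) / H) ^ d := by gcongr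
        _ = 4 ^ d := by
          rw [← mul_pow]
          congr 1
          rw [one_div_pow]
          field_simp
          ring
    have hreal : (Set.ncard {n | ∀ m,
        |faceCoord Ω a b (p n) m - faceCoord Ω a b (p n₀) m| ≤ (1 / 2) ^ S} : ℝ) ≤ B := by
      refine le_trans ?_ (Nat.le_ceil _)
      refine le_trans (Nat.cast_le.mpr (Set.ncard_le_ncard hsub (Set.toFinite _))) ?_
      exact hcount.trans (by gcongr)
    exact_mod_cast hreal
  obtain ⟨σ, hcard, hσ⟩ := exists_representatives (fun n => faceCoord Ω a b (p n)) J
    (fun n => faceCoord_nonneg b (hp.1 n)) (fun n => faceCoord_le_one b (hp.1 n)) S Q B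
    (Nat.le_add_left 1 _) hcell
  refine ⟨σ, ?_, fun n y hy => ?_⟩
  · calc ((Finset.univ.image σ).card : ℝ)
        ≤ ((B * ((S + 1) * ((2 * Q) ^ d * 2 ^ (S * J.card))) : ℕ) : ℝ) := Nat.cast_le.mpr hcard
      _ = B * (2 * Q) ^ d * (((S + 1 : ℕ) : ℝ) * 2 ^ (S * J.card)) := by push_cast; ring
      _ ≤ B * (2 * Q) ^ d * (3 * ((N : ℝ) ^ ((J.card : ℝ) / d) * Real.log N)) := by
          exact mul_le_mul_of_nonneg_left (levels_mul_cells_le hd hN _) (by positivity)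
      _ = _ := by ring
  · rcases hσ n with h | ⟨m, hm, h⟩
    · rw [h, dist_self]; positivity
    · have hQ : 2 * √d / Q ≤ θ := by
        have h1 : 2 * √d / θ ≤ Q := (Nat.le_ceil _).trans (by simp [Q])
        rw [div_le_iff₀ (by positivity)]
        rwa [div_le_iff₀ hθ, mul_comm (Q : ℝ)] at h1
      have h0 := faceCoord_nonneg b (hp.1 n) m
      calc dist (p n) (p (σ n)) ≤ √d * (2 / Q * faceCoord Ω a b (p n) m * H) := by
            refine dist_le_of_forall_abs_sub_le (by positivity) fun m' => ?_
            have := h m'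
            rwa [abs_faceCoord_sub, div_le_iff₀ hpos] at this
        _ = 2 * √d / Q * (faceCoord Ω a b (p n) m * H) := by ring
        _ ≤ θ * dist y (p n) := by
            gcongr
            exact faceCoord_mul_le_dist hy hm

/-! ### Variation of an asymptotically smooth kernel -/

/-- Grönwall's inequality along the segment from `y` to `z`, whose points all have distance at least
`‖x - y‖ / 2` from `x`. -/
theorem norm_sub_le_of_norm_fderiv_le {E : Type*} [NormedAddCommGroup E] [NormedSpace ℝ E]
    {f : E → ℂ} {x y z : E} {A θ : ℝ} (hA : 0 < A) (hθ0 : 0 < θ) (hθ : θ ≤ 1 / 2)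
    (hyz : ‖y - z‖ ≤ θ * ‖x - y‖)
    (hf : ∀ w ∈ segment ℝ y z, x ≠ w →
      DifferentiableAt ℝ f w ∧ ‖fderiv ℝ f w‖ ≤ A * ‖f w‖ / ‖x - w‖) :
    ‖f y - f z‖ ≤ (Real.exp (2 * A * θ) - 1) * ‖f y‖ := by
  rcases eq_or_ne x y with rfl | hxy
  · have : x - z = 0 := by simpa using hyz
    rw [← sub_eq_zero.mp this, sub_self, norm_zero]
    have := Real.add_one_le_exp (2 * A * θ)
    have : 0 ≤ 2 * A * θ := by positivity
    exact mul_nonneg (by linarith) (norm_nonneg _)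
  have hpos : 0 < ‖x - y‖ := norm_pos_iff.mpr (sub_ne_zero.mpr hxy)
  let w : ℝ → E := fun t => y + t • (z - y)
  have hw : ∀ t, HasDerivAt w (z - y) t := fun t => by
    simpa [w] using! ((hasDerivAt_id t).smul_const (z - y)).const_add y
  have hwseg : ∀ t ∈ Set.Icc (0 : ℝ) 1, w t ∈ segment ℝ y z := fun t ht => by
    rw [segment_eq_image']; exact ⟨t, ht, rfl⟩
  have hdist : ∀ t ∈ Set.Icc (0 : ℝ) 1, 1 / 2 * ‖x - y‖ ≤ ‖x - w t‖ := by
    intro t ht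
    have e : x - y = (x - w t) + t • (z - y) := by simp only [w]; abel
    have h1 : ‖x - y‖ ≤ ‖x - w t‖ + ‖t • (z - y)‖ := by
      conv_lhs => rw [e]
      exact norm_add_le _ _
    have h2 : ‖t • (z - y)‖ ≤ ‖y - z‖ := by
      rw [norm_smul, norm_sub_rev z y, Real.norm_of_nonneg ht.1]
      exact mul_le_of_le_one_left (norm_nonneg _) ht.2
    nlinarith
  have hne : ∀ t ∈ Set.Icc (0 : ℝ) 1, x ≠ w t := fun t ht h => by
    have := hdist t ht
    rw [← h, sub_self, norm_zero] at this
    linarith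
  have hderiv : ∀ t ∈ Set.Icc (0 : ℝ) 1,
      HasDerivAt (fun t => f (w t) - f y) (fderiv ℝ f (w t) (z - y)) t := fun t ht =>
    ((hf _ (hwseg t ht) (hne t ht)).1.hasFDerivAt.comp_hasDerivAt t (hw t)).sub_const _
  have key := norm_le_gronwallBound_of_norm_deriv_right_le
    (f := fun t => f (w t) - f y) (f' := fun t => fderiv ℝ f (w t) (z - y))
    (δ := 0) (K := 2 * A * θ) (ε := 2 * A * θ * ‖f y‖) (a := 0) (b := 1)
    (fun t ht => (hderiv t ht).continuousAt.continuousWithinAt)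
    (fun t ht => (hderiv t ⟨ht.1, ht.2.le⟩).hasDerivWithinAt)
    (by simp [w])
    (fun t ht => by
      have ht' : t ∈ Set.Icc (0 : ℝ) 1 := ⟨ht.1, ht.2.le⟩
      have hd := hdist t ht'
      have hwpos : 0 < ‖x - w t‖ := by linarith
      calc ‖fderiv ℝ f (w t) (z - y)‖ ≤ ‖fderiv ℝ f (w t)‖ * ‖z - y‖ :=
            ContinuousLinearMap.le_opNorm _ _
        _ ≤ A * ‖f (w t)‖ / ‖x - w t‖ * (2 * θ * ‖x - w t‖) := by
            gcongr
            · exact (hf _ (hwseg t ht') (hne t ht')).2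
            · rw [norm_sub_rev]; nlinarith
        _ = 2 * A * θ * ‖f (w t)‖ := by field_simp
        _ ≤ 2 * A * θ * (‖f (w t) - f y‖ + ‖f y‖) := by
            gcongr
            simpa using norm_add_le (f (w t) - f y) (f y)
        _ = _ := by ring)
    1 (by simp)
  rw [gronwallBound_of_K_ne_0 (by positivity)] at key
  rw [norm_sub_rev]
  simp only [w, one_smul, add_sub_cancel, sub_zero, mul_one, zero_mul, zero_add] at key
  refine key.trans_eq ?_
  field_simp

/-- For `θ` small enough, moving one argument of the kernel by at most `θ` times the distance of the
two arguments changes the value by at most `ε` times its modulus. Only the derivative bounds of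
order one are used. -/
theorem AsymptoticallySmoothOn.exists_ratio {d : ℕ} {c γ ε : ℝ} (hc : 0 < c) (hγ : 0 < γ)
    (hε : 0 < ε) :
    ∃ θ : ℝ, 0 < θ ∧ ∀ (F : EuclideanSpace ℝ (Fin d) → EuclideanSpace ℝ (Fin d) → ℂ)
      (D X : Set (EuclideanSpace ℝ (Fin d))), AsymptoticallySmoothOn c γ F D → Convex ℝ X → X ⊆ D →
      ∀ x ∈ D, ∀ y ∈ X, ∀ z ∈ X, dist y z ≤ θ * dist x y →
        ‖F x y - F x z‖ ≤ ε * ‖F x y‖ ∧ ‖F y x - F z x‖ ≤ ε * ‖F y x‖ := by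
  have hlog : 0 < Real.log (1 + ε) := Real.log_pos (by linarith)
  -- `θ ≤ log (1 + ε) / (2 c γ)` makes the Grönwall factor `exp (2 c γ θ) - 1` at most `ε`
  refine ⟨min (1 / 2) (Real.log (1 + ε) / (2 * (c * γ))), by positivity,
    fun F D X hF hX hXD x hx y hy z hz hyz => ?_⟩
  set θ := min (1 / 2) (Real.log (1 + ε) / (2 * (c * γ))) with hθ
  have hθ0 : 0 < θ := by positivity
  have hexp : Real.exp (2 * (c * γ) * θ) - 1 ≤ ε := by
    have h1 : 2 * (c * γ) * θ ≤ Real.log (1 + ε) := by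
      have := min_le_right (1 / 2) (Real.log (1 + ε) / (2 * (c * γ)))
      rwa [← hθ, le_div_iff₀' (by positivity)] at this
    have := Real.exp_le_exp.mpr h1
    rw [Real.exp_log (by linarith)] at this
    linarith
  rw [dist_eq_norm, dist_eq_norm] at hyz
  constructor
  · refine (norm_sub_le_of_norm_fderiv_le (f := fun w => F x w) (A := c * γ) (by positivity) hθ0
      (min_le_left _ _) hyz fun w hw hne => ?_).trans (by gcongr)
    obtain ⟨h1, -, h3⟩ := hF x hx w (hXD (hX.segment_subset hy hz hw)) hne
    refine ⟨h1.differentiableAt (by simp), ?_⟩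
    simpa [norm_iteratedFDeriv_one] using! (h3 1).1
  · refine (norm_sub_le_of_norm_fderiv_le (f := fun w => F w x) (A := c * γ) (by positivity) hθ0
      (min_le_left _ _) hyz fun w hw hne => ?_).trans (by gcongr)
    obtain ⟨-, h2, h3⟩ := hF w (hXD (hX.segment_subset hy hz hw)) x hx hne.symm
    refine ⟨h2.differentiableAt (by simp), ?_⟩
    have := (h3 1).2
    rw [norm_sub_rev w x] at this
    simpa [norm_iteratedFDeriv_one] using! this

/-! ### Low-rank approximation of the fill-in -/

theorem rank_submatrix_id_le {m n : Type*} [Fintype m] [Fintype n] [DecidableEq n]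
    (A : Matrix m n ℂ) (σ : n → n) :
    (A.submatrix id σ).rank ≤ (Finset.univ.image σ).card := by
  classical
  rw [Matrix.rank_eq_finrank_span_cols]
  have : Set.range (A.submatrix id σ).col ⊆ ((Finset.univ.image σ).image A.col : Finset (m → ℂ)) := by
    rintro _ ⟨n, rfl⟩
    simp only [Finset.coe_image, Finset.coe_univ, Set.image_univ]
    exact ⟨σ n, ⟨n, rfl⟩, rfl⟩
  exact (Submodule.finrank_mono (Submodule.span_mono this)).trans
    ((finrank_span_finset_le_card _).trans Finset.card_image_le)

theorem norm_mul_apply_le {N : ℕ} {A B : Matrix (Fin N) (Fin N) ℂ}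
    {X Y : Matrix (Fin N) (Fin N) ℝ} (hA : ∀ m n, ‖A m n‖ ≤ X m n) (hB : ∀ m n, ‖B m n‖ ≤ Y m n)
    (m n : Fin N) : ‖(A * B) m n‖ ≤ (X * Y) m n := by
  rw [Matrix.mul_apply, Matrix.mul_apply]
  refine norm_sum_le_of_le _ fun q _ => ?_
  rw [norm_mul]
  exact mul_le_mul (hA m q) (hB q n) (norm_nonneg _) ((norm_nonneg _).trans (hA m q))

/-- A low-rank matrix that approximates the fill-in up to `ε |K_ji| |K_ii| |K_ik|`: either the columns
of `K_ji` or the rows of `K_ik` are replaced by those of cluster representatives, whichever needs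
fewer clusters. -/
theorem exists_approx_fillInP2P {d : ℕ} (hd : 1 ≤ d) {ε c γ Cu : ℝ} (hε : 0 < ε) (hc : 0 < c)
    (hγ : 0 < γ) (hCu : 0 < Cu) :
    ∃ A : ℝ, 0 < A ∧ ∀ (Ω : RootCube d) (L : ℕ) (i j k : Box d L)
      (F : EuclideanSpace ℝ (Fin d) → EuclideanSpace ℝ (Fin d) → ℂ),
      AsymptoticallySmoothOn c γ F (cube Ω i ∪ cube Ω j ∪ cube Ω k) →
      ∀ (N : ℕ) (u v : Box d L → Fin N → EuclideanSpace ℝ (Fin d)), 3 ≤ N →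
        (∀ b ∈ ({i, j, k} : Set (Box d L)),
          UniformlyDistributed Cu Ω b (u b) ∧ UniformlyDistributed Cu Ω b (v b)) →
      ∃ B : Matrix (Fin N) (Fin N) ℂ,
        (B.rank : ℝ) ≤ A * ((N : ℝ) ^ (((min (sharedDirections i j).card
          (sharedDirections i k).card : ℕ) : ℝ) / d) * Real.log N) ∧
        ∀ m n, ‖fillInP2P F u v i j k m n - B m n‖ ≤ ε * fillInMagnitude F u v i j k m n := by
  obtain ⟨θ, hθ, hsmooth⟩ := AsymptoticallySmoothOn.exists_ratio (d := d) hc hγ hε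
  obtain ⟨A, hA, hcluster⟩ := exists_clustering hd hCu hθ
  refine ⟨A, hA, fun Ω L i j k F hF N u v hN huv => ?_⟩
  obtain ⟨hui, hvi⟩ := huv i (by simp)
  have huj := (huv j (by simp)).1
  have hvk := (huv k (by simp)).2
  have hiD : cube Ω i ⊆ cube Ω i ∪ cube Ω j ∪ cube Ω k := fun x hx => Or.inl (Or.inl hx)
  have hle (G : Matrix (Fin N) (Fin N) ℂ) (m n : Fin N) : ‖G m n‖ ≤ entryAbs G m n := le_rfl
  rcases le_total (sharedDirections i j).card (sharedDirections i k).card with h | h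
  · rw [min_eq_left h]
    obtain ⟨σ, hcard, hσ⟩ := hcluster Ω L i j N (v i) hN hvi
    set K := interaction F u v j i with hK
    refine ⟨-(K.submatrix id σ * interaction F u v i i * interaction F u v i k), ?_, ?_⟩
    · refine le_trans (Nat.cast_le.mpr ?_) hcard
      rw [← Matrix.neg_mul, ← Matrix.neg_mul, Matrix.mul_assoc]
      exact (Matrix.rank_mul_le_left _ _).trans (rank_submatrix_id_le (-K) σ)
    · have hK' : ∀ m n, ‖(K - K.submatrix id σ) m n‖ ≤ (ε • entryAbs K) m n := fun m n =>
        (hsmooth F _ _ hF (convex_cube Ω i) hiD (u j m) (Or.inl (Or.inr (huj.1 m))) (v i n)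
          (hvi.1 n) (v i (σ n)) (hvi.1 _) (hσ n _ (huj.1 m))).1
      intro m n
      have := norm_mul_apply_le (norm_mul_apply_le hK' (hle (interaction F u v i i)))
        (hle (interaction F u v i k)) m n
      rw [Matrix.smul_mul, Matrix.smul_mul] at this
      rw [← Matrix.sub_apply, fillInP2P, ← hK, neg_sub_neg, ← Matrix.sub_mul, ← Matrix.sub_mul,
        ← neg_sub, Matrix.neg_mul, Matrix.neg_mul, Matrix.neg_apply, norm_neg]
      exact this
  · rw [min_eq_right h]
    obtain ⟨σ, hcard, hσ⟩ := hcluster Ω L i k N (u i) hN hui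
    set K := interaction F u v i k with hK
    refine ⟨-(interaction F u v j i * interaction F u v i i * K.submatrix σ id), ?_, ?_⟩
    · refine le_trans (Nat.cast_le.mpr ?_) hcard
      rw [← Matrix.mul_neg]
      refine (Matrix.rank_mul_le_right _ _).trans ?_
      rw [← Matrix.rank_transpose]
      exact rank_submatrix_id_le (-K).transpose σ
    · have hK' : ∀ m n, ‖(K - K.submatrix σ id) m n‖ ≤ (ε • entryAbs K) m n := fun m n =>
        (hsmooth F _ _ hF (convex_cube Ω i) hiD (v k n) (Or.inr (hvk.1 n)) (u i m)
          (hui.1 m) (u i (σ m)) (hui.1 _) (hσ m _ (hvk.1 n))).2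
      intro m n
      have := norm_mul_apply_le (norm_mul_apply_le (hle (interaction F u v j i))
        (hle (interaction F u v i i))) hK' m n
      rw [Matrix.mul_smul] at this
      rw [← Matrix.sub_apply, fillInP2P, ← hK, neg_sub_neg, ← Matrix.mul_sub,
        ← neg_sub, Matrix.mul_neg, Matrix.neg_apply, norm_neg]
      exact this

/-! ### Numerical ranks and rates -/

theorem numRankRel_le {N : ℕ} {ε : ℝ} {S : Matrix (Fin N) (Fin N) ℝ}
    {A B : Matrix (Fin N) (Fin N) ℂ} (h : ∀ m n, ‖A m n - B m n‖ ≤ ε * S m n) :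
    numRankRel ε S A ≤ B.rank :=
  Nat.sInf_le ⟨B, rfl, h⟩

theorem numRank_le {N : ℕ} {ε : ℝ} {A B : Matrix (Fin N) (Fin N) ℂ}
    (h : maxNorm (A - B) ≤ ε * maxNorm A) : numRank ε A ≤ B.rank :=
  Nat.sInf_le ⟨B, rfl, h⟩

theorem norm_apply_le_maxNorm {N : ℕ} {R : Type*} [Norm R] (A : Matrix (Fin N) (Fin N) R)
    (m n : Fin N) : ‖A m n‖ ≤ maxNorm A :=
  le_ciSup (f := fun q : Fin N × Fin N => ‖A q.1 q.2‖) (Set.finite_range _).bddAbove (m, n)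

theorem maxNorm_le {N : ℕ} (hN : 0 < N) {A : Matrix (Fin N) (Fin N) ℂ} {t : ℝ}
    (h : ∀ m n, ‖A m n‖ ≤ t) : maxNorm A ≤ t :=
  have : Nonempty (Fin N) := ⟨⟨0, hN⟩⟩
  ciSup_le fun q => h q.1 q.2

/-- The bound `A N^(e/d) log N` implies both rates: `log N ≤ log^d N` as `log N ≥ 1`, and
`log (log N)` is at least the positive constant `log (log 3)`. -/
theorem obeysRates_of_le {d e dj dk N r : ℕ} {A : ℝ} (hd : 1 ≤ d) (hA : 0 < A) (hN : 3 ≤ N)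
    (he : e ≤ min dj dk) (hr : (r : ℝ) ≤ A * ((N : ℝ) ^ ((e : ℝ) / d) * Real.log N)) :
    ObeysRates d (A / Real.log (Real.log 3) ^ d) dj dk N r := by
  have h3 : 1 < Real.log 3 := by
    rw [Real.lt_log_iff_exp_lt (by norm_num)]
    linarith [Real.exp_one_lt_d9]
  have hll : 0 < Real.log (Real.log 3) := Real.log_pos h3
  have hll1 : Real.log (Real.log 3) ≤ 1 := by
    have h1 := Real.log_le_sub_one_of_pos (zero_lt_one.trans h3)
    have h2 := Real.log_le_sub_one_of_pos (show (0 : ℝ) < 3 by norm_num)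
    linarith
  have hN' : (3 : ℝ) ≤ N := by exact_mod_cast hN
  have hlog := one_le_log_of_three_le hN
  refine ⟨fun h => ?_, fun h1 h2 => ?_⟩
  · obtain rfl : e = 0 := by omega
    have hmono : Real.log (Real.log 3) ≤ Real.log (Real.log N) :=
      Real.log_le_log (by linarith) (Real.log_le_log (by norm_num) hN')
    calc (r : ℝ) ≤ A * Real.log N := by simpa using hr
      _ = A / Real.log (Real.log 3) ^ d * (Real.log N * Real.log (Real.log 3) ^ d) := by field_simp
      _ ≤ _ := by gcongr
  · have hC : A ≤ A / Real.log (Real.log 3) ^ d :=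
      le_div_self hA.le (by positivity) (pow_le_one₀ hll.le hll1)
    refine hr.trans ?_
    gcongr
    · linarith
    · exact le_self_pow₀ hlog (by omega)

theorem exists_rate_lt_self {d : ℕ} (hd : 1 ≤ d) {A : ℝ} (hA : 0 < A) :
    ∃ N₀ : ℕ, ∀ N : ℕ, N₀ ≤ N → 3 ≤ N → ∀ e : ℕ, e < d →
      A * ((N : ℝ) ^ ((e : ℝ) / d) * Real.log N) < N := by
  have hd0 : (0 : ℝ) < d := by exact_mod_cast hd
  have h := ((isLittleO_log_rpow_atTop (one_div_pos.mpr hd0)).comp_tendsto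
    tendsto_natCast_atTop_atTop).def (c := 1 / (2 * A)) (by positivity)
  obtain ⟨N₀, hN₀⟩ := Filter.eventually_atTop.mp h
  refine ⟨N₀, fun N hN h3 e he => ?_⟩
  have hN0 : (0 : ℝ) < N := by positivity
  have hN1 : (1 : ℝ) ≤ N := by exact_mod_cast (by omega : 1 ≤ N)
  have hlog : Real.log N ≤ 1 / (2 * A) * (N : ℝ) ^ (1 / (d : ℝ)) := by
    have := hN₀ N hN
    simp only [Function.comp_apply, Real.norm_eq_abs] at this
    rw [abs_of_nonneg (by positivity : 0 ≤ (N : ℝ) ^ (1 / (d : ℝ)))] at this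
    exact (le_abs_self _).trans this
  have hexp : (e : ℝ) / d + 1 / d ≤ 1 := by
    rw [← add_div, div_le_one hd0]
    exact_mod_cast he
  calc A * ((N : ℝ) ^ ((e : ℝ) / d) * Real.log N)
      ≤ A * ((N : ℝ) ^ ((e : ℝ) / d) * (1 / (2 * A) * (N : ℝ) ^ (1 / (d : ℝ)))) := by gcongr
    _ = 1 / 2 * (N : ℝ) ^ ((e : ℝ) / d + 1 / d) := by
        rw [Real.rpow_add hN0]; field_simp
    _ ≤ 1 / 2 * (N : ℝ) ^ (1 : ℝ) := by gcongr
    _ < N := by rw [Real.rpow_one]; linarith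

theorem theorem1 (d : ℕ) (hd : 1 ≤ d) (ε c γ Cu κ : ℝ) (hε : 0 < ε) (hc : 0 < c) (hγ : 0 < γ)
    (hCu : 0 < Cu) (hκ : 1 ≤ κ) :
    ∃ (C : ℝ) (N₀ : ℕ), 0 < C ∧
      ∀ (Ω : RootCube d) (L : ℕ) (i j k : Box d L),
        j ∈ neighbours Ω i → k ∈ neighbours Ω i → j ∈ interactionList Ω k →
      ∀ F : EuclideanSpace ℝ (Fin d) → EuclideanSpace ℝ (Fin d) → ℂ,
        AsymptoticallySmoothOn c γ F (cube Ω i ∪ cube Ω j ∪ cube Ω k) →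
      ∀ (N : ℕ) (u v : Box d L → Fin N → EuclideanSpace ℝ (Fin d)), 3 ≤ N →
        (∀ b ∈ ({i, j, k} : Set (Box d L)),
          UniformlyDistributed Cu Ω b (u b) ∧ UniformlyDistributed Cu Ω b (v b)) →
        (ObeysRates d C (sharedDim Ω i j) (sharedDim Ω i k) N
            (numRankRel ε (fillInMagnitude F u v i j k) (fillInP2P F u v i j k)) ∧
          (N₀ ≤ N →
            numRankRel ε (fillInMagnitude F u v i j k) (fillInP2P F u v i j k) < N)) ∧
        (maxNorm (fillInMagnitude F u v i j k) ≤ κ * maxNorm (fillInP2P F u v i j k) →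
          ObeysRates d C (sharedDim Ω i j) (sharedDim Ω i k) N
            (numRank ε (fillInP2P F u v i j k)) ∧
          (N₀ ≤ N → numRank ε (fillInP2P F u v i j k) < N)) := by
  have hκ0 : 0 < κ := zero_lt_one.trans_le hκ
  -- tolerance `ε / κ` serves both numerical ranks with the same approximation
  obtain ⟨A, hA, happrox⟩ := exists_approx_fillInP2P hd (div_pos hε hκ0) hc hγ hCu
  obtain ⟨N₀, hN₀⟩ := exists_rate_lt_self hd hA
  have hlog3 : 1 < Real.log 3 := by
    rw [Real.lt_log_iff_exp_lt (by norm_num)]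
    linarith [Real.exp_one_lt_d9]
  have hloglog : 0 < Real.log (Real.log 3) := Real.log_pos hlog3
  refine ⟨A / Real.log (Real.log 3) ^ d, N₀, by positivity, ?_⟩
  intro Ω L i j k hj hk hjk F hF N u v hN huv
  obtain ⟨B, hrank, hB⟩ := happrox Ω L i j k F hF N u v hN huv
  set e := min (sharedDirections i j).card (sharedDirections i k).card
  have he : e ≤ min (sharedDim Ω i j) (sharedDim Ω i k) :=
    min_le_min (card_sharedDirections_le_sharedDim hj) (card_sharedDirections_le_sharedDim hk)
  have hed : e < d := (min_le_left _ _).trans_lt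
    (card_sharedDirections_lt (ne_of_mem_interactionList hk hjk))
  have conclude (r : ℕ) (hr : r ≤ B.rank) :
      ObeysRates d (A / Real.log (Real.log 3) ^ d) (sharedDim Ω i j) (sharedDim Ω i k) N r ∧
        (N₀ ≤ N → r < N) := by
    have hr' := (Nat.cast_le (α := ℝ).mpr hr).trans hrank
    exact ⟨obeysRates_of_le hd hA hN he hr', fun h =>
      Nat.cast_lt (α := ℝ).mp (hr'.trans_lt (hN₀ N h hN e hed))⟩
  refine ⟨conclude _ (numRankRel_le fun m n => (hB m n).trans ?_), fun hM =>
    conclude _ (numRank_le (maxNorm_le (by omega) fun m n => (hB m n).trans ?_))⟩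
  · have hM0 : 0 ≤ fillInMagnitude F u v i j k m n :=
      nonneg_of_mul_nonneg_right ((norm_nonneg _).trans (hB m n)) (div_pos hε hκ0)
    exact mul_le_mul_of_nonneg_right (div_le_self hε.le hκ) hM0
  · calc ε / κ * fillInMagnitude F u v i j k m n
        ≤ ε / κ * maxNorm (fillInMagnitude F u v i j k) := by
          gcongr
          exact (Real.le_norm_self _).trans (norm_apply_le_maxNorm (fillInMagnitude F u v i j k) m n)
      _ ≤ ε / κ * (κ * maxNorm (fillInP2P F u v i j k)) := by gcongr
      _ = ε * maxNorm (fillInP2P F u v i j k) := by field_simp
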